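/- \textbf{Setting.} Let $Z_1,Z_2,\dots$ be i.i.d. random elements of a measurable space $\mathcal Z$ with law $\mu$, let $L$ be a measure on $\mathcal Z$ (for example Lebesgue measure), and let $R(z;\xi)$, $z\in\mathcal Z$, $\xi\in\Xi$, be a real score, measurable in $z$, where $(\Xi,d)$ is a (pseudo)metric space. Assume (A1) $\ |R(z;\xi)-R(z;\xi')|\le d(\xi,\xi')$ for all $z,\xi,\xi'$. Fix $\xi^*\in\Xi$, $\alpha\in(0,1)$, $\eta>1$, and $h,\mathsf g:\mathbb N\to[0,\infty)$ with $\sum_{s\ge0}h(s)=\sum_{k\ge0}\mathsf g(k)=1$. For each $k\ge0$ let $\hat\xi^{(k)}$ be an estimate of $\xi^*$, i.e. an arbitrary $\Xi$-valued random element (for example one computed from the observations made before time $\eta^k$). \textbf{Online set.} Put $s_{t,k}=t-\lceil\eta^k\rceil+1$ and $\hat F_{t,k}(r)=\frac1{s_{t,k}}\sum_{s=\lceil\eta^k\rceil}^{t}\mathbf 1\{R(Z_s;\hat\xi^{(k)})\le r\}$. Let $$u_{t,k}=\frac{4(2\alpha-1)\log\frac1{h(s_{t,k})}}{3(s_{t,k}+3)}+\sqrt{\frac{2\alpha(1-\alpha)}{s_{t,k}+2}}\left(\sqrt{\log\frac1{h(s_{t,k})}}+\sqrt{\log\sum_{t'=t_k+1}^{\lfloor\eta^{k+2}\rfloor}\frac{h(s_{t',k})}{\mathsf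 g(k)}}+\frac{\sqrt\pi}2\right)$$ (with $u_{t,k}=+\infty$ if $h(s_{t,k})=0$ or $\mathsf g(k)=0$, and the root of a negative number read as $0$), and $$\hat q_{t,k}=\inf\left\{r\in\mathbb R:\ \tfrac{s_{t,k}}{s_{t,k}+1}\hat F_{t,k}(r)\ge1-\alpha+u_{t,k}\right\}\in[-\infty,\infty],$$ where $t_k$ is the smallest natural number such that $\hat q_{t,k}$, computed with this $t_k$, is finite for all integers $t\in(t_k,\eta^{k+2})$. Let $\hat C_{t,k}=\{z:R(z;\hat\xi^{(k)})\le\hat q_{t,k}\}$. For $t\in[\eta^k,\eta^{k+1})$ put $j=\max(k-1,0)$; the online TUC set $\hat C_t$ is the one of $\hat C_{t,j}$ and $\hat C_{t,k}$ with the smaller value of $L$. \textbf{Oracle.} For $\beta\in[-\infty,\infty]$ let $q^*_\beta=\inf\{r\in\mathbb R:\mu(R(\cdot;\xi^*)\le r)\ge1-\beta\}\in[-\infty,\infty]$ be the $(1-\beta)$-quantile of $R(Z;\xi^*)$, $Z\sim\mu$. Let $C^*=\{z:R(z;\xi^*)\le q^*_\alpha\}$ and, for $\varepsilon\in[0,\infty]$,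 $$g(\varepsilon)=L\{z:|R(z;\xi^*)-q^*_\alpha|<\varepsilon\},\qquad\bar g(\varepsilon)=L\{z:|R(z;\xi^*)-q^*_\alpha|\le\varepsilon\}.$$ \textbf{Theorem.} (i) For all $\kappa\in(0,1)$ and $t\ge1$, with probability at least $1-\kappa$, $$L(\hat C_t)\le L(C^*)+\bar g\left(2d(\xi^*,\hat\xi^{(j)})+\max_{\omega\in\{\pm1\}}\left|q^*_\alpha-q^*_{\alpha-u_{t,j}+\omega\sqrt{\eta\log(2/\kappa)/(2t(\eta-1))}}\right|\right).$$ (ii) If the distribution function of $R(Z;\xi^*)$ is continuous, the same holds with $g$ in place of $\bar g$. (iii) Suppose that, in a neighborhood of $q^*_\alpha$, $R(Z;\xi^*)$ has a density that is bounded away from zero, that $g(\varepsilon)\asymp\varepsilon$ as $\varepsilon\downarrow0$, that $d(\xi^*,\hat\xi^{(k)})\to0$ in probability as $k\to\infty$, and that $u_{t,j}\to0$ as $t\to\infty$ (where $j=j(t)$). Then there are nonnegative (possibly infinite) random $A_t=O_{\mathbb P}(1)$ and $B_t=O_{\mathbb P}(1)$ such that, for all large enough $t$, $$L(\hat C_t)\le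 L(C^*)+A_t\,d(\xi^*,\hat\xi^{(j)})+B_t\left(\frac1{\sqrt t}+|u_{t,j}|\right).$$ Probabilities of events that may fail to be measurable are read as: the complement has outer probability at most $\kappa$. -/

import Mathlib

open MeasureTheory ProbabilityTheory Filter Topology
open scoped NNReal ENNReal

namespace OnlineTUC

noncomputable section

/-- Generalised inverse `p ↦ inf {r ∈ ℝ : p ≤ F r}` with values in `[-∞, ∞]`
(`inf ∅ = ∞`, and the infimum over all of `ℝ` is `-∞`). -/
def genInv (F : ℝ → ℝ) (p : EReal) : EReal :=
  sInf {r : EReal | ∃ x : ℝ, r = (x : EReal) ∧ p ≤ ((F x : ℝ) : EReal)}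

/-! ### The online procedure

Observations are indexed by `t = 1, 2, …`. Epoch `k` consists of the times `η ^ k ≤ t < η ^ (k+1)`,
and the transformation of epoch `k` is calibrated on the observations `⌈η ^ k⌉, …, t`. -/

/-- The epoch of time `t`: the `k` with `η ^ k ≤ t < η ^ (k + 1)`, see `epoch_spec`. -/
def epoch (η : ℝ) (t : ℕ) : ℕ := ⌊Real.logb η t⌋₊

theorem epoch_spec {η : ℝ} (hη : 1 < η) {t : ℕ} (ht : 1 ≤ t) :
    η ^ epoch η t ≤ t ∧ (t : ℝ) < η ^ (epoch η t + 1) := by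
  have ht1 : (1 : ℝ) ≤ t := by exact_mod_cast ht
  have ht0 : (0 : ℝ) < t := by linarith
  have hnn : 0 ≤ Real.logb η t := Real.logb_nonneg hη ht1
  constructor
  · have h := Nat.floor_le hnn
    rw [Real.le_logb_iff_rpow_le hη ht0, Real.rpow_natCast] at h
    exact h
  · have h := Nat.lt_floor_add_one (Real.logb η t)
    rw [Real.logb_lt_iff_lt_rpow hη ht0] at h
    have e : ((⌊Real.logb η t⌋₊ : ℝ) + 1) = ((⌊Real.logb η t⌋₊ + 1 : ℕ) : ℝ) := by
      push_cast; rfl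
    rw [e, Real.rpow_natCast] at h
    exact h

/-- `s_{t,k} = t - (⌈η ^ k⌉ - 1)`, the number of calibration points of epoch `k` at time `t`. -/
def calSize (η : ℝ) (t k : ℕ) : ℕ := t + 1 - ⌈η ^ k⌉₊

/-- Empirical distribution function at `r` of the calibration scores `x ⌈η ^ k⌉, …, x t`. -/
def empCDF (η : ℝ) (t k : ℕ) (x : ℕ → ℝ) (r : ℝ) : ℝ :=
  (1 / (calSize η t k : ℝ)) *
    ∑ s ∈ Finset.Icc ⌈η ^ k⌉₊ t, (Set.Iic r).indicator (fun _ => (1 : ℝ)) (x s)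

/-- `inf {r : s/(s+1) · F̂_{t,k}(r) ≥ 1 - α + u}` with `s = s_{t,k}`, for calibration scores `x`. -/
def calQuantile (α η : ℝ) (t k : ℕ) (u : EReal) (x : ℕ → ℝ) : EReal :=
  genInv (fun r => (calSize η t k : ℝ) / ((calSize η t k : ℝ) + 1) * empCDF η t k x r)
    (((1 - α : ℝ) : EReal) + u)

/-- The correction `u_{t,k}` computed with the value `τ` in place of `t_k`. It is `+∞` when
`h (s_{t,k}) = 0` or `g k = 0`; the root of a negative number is read as `0`. -/
def correctionAt (α η : ℝ) (h g : ℕ → ℝ≥0) (τ t k : ℕ) : EReal :=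
  if h (calSize η t k) = 0 ∨ g k = 0 then ⊤ else
    ((4 * (2 * α - 1) * Real.log (1 / (h (calSize η t k) : ℝ))
          / (3 * ((calSize η t k : ℝ) + 3))
        + √(2 * α * (1 - α) / ((calSize η t k : ℝ) + 2))
          * (√(Real.log (1 / (h (calSize η t k) : ℝ)))
            + √(Real.log (∑ t' ∈ Finset.Icc (τ + 1) ⌊η ^ (k + 2)⌋₊,
                (h (calSize η t' k) : ℝ) / (g k : ℝ)))
            + √Real.pi / 2) : ℝ) : EReal)

/-- `t_k`: the smallest natural number such that the calibration quantile `q̂_{t,k}` is finite for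
all `t ∈ (t_k, η ^ (k+2))`, where `q̂_{t,k}` is itself computed with this `t_k`. (Finiteness does
not depend on the values of the scores.) -/
def startTime (α η : ℝ) (h g : ℕ → ℝ≥0) (k : ℕ) : ℕ :=
  sInf {τ : ℕ | ∀ t : ℕ, τ < t → (t : ℝ) < η ^ (k + 2) → ∀ x : ℕ → ℝ,
    calQuantile α η t k (correctionAt α η h g τ t k) x ≠ ⊤ ∧
    calQuantile α η t k (correctionAt α η h g τ t k) x ≠ ⊥}

/-- The correction `u_{t,k}`. -/
def correction (α η : ℝ) (h g : ℕ → ℝ≥0) (t k : ℕ) : EReal :=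
  correctionAt α η h g (startTime α η h g k) t k

section Sets

variable {𝒵 Ξ : Type*} [MeasurableSpace 𝒵]

/-- `Ĉ_{t,j} = {z : R(z; ξ̂^{(j)}) ≤ q̂_{t,j}}` on a realisation `ξ j = ξ̂^{(j)}` of the nuisance
estimates and `z 1, z 2, …` of the data. -/
def epochSet (R : 𝒵 → Ξ → ℝ) (α η : ℝ) (h g : ℕ → ℝ≥0) (ξ : ℕ → Ξ) (z : ℕ → 𝒵) (t j : ℕ) :
    Set 𝒵 :=
  {x | ((R x (ξ j) : ℝ) : EReal) ≤
    calQuantile α η t j (correction α η h g t j) (fun s => R (z s) (ξ j))}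

/-- The index of the preceding epoch, `k - 1` for `t` in epoch `k ≥ 1`; in the initial epoch only
the starting transformation is available, and the index is `0`. -/
def prevEpoch (η : ℝ) (t : ℕ) : ℕ := epoch η t - 1

/-- The reported set `Ĉ_t`: the one of smaller size among `Ĉ_{t,k-1}` and `Ĉ_{t,k}`, for `t` in
epoch `k`. -/
def onlineSet (L : Measure 𝒵) (R : 𝒵 → Ξ → ℝ) (α η : ℝ) (h g : ℕ → ℝ≥0) (ξ : ℕ → Ξ)
    (z : ℕ → 𝒵) (t : ℕ) : Set 𝒵 :=
  if L (epochSet R α η h g ξ z t (prevEpoch η t)) ≤ L (epochSet R α η h g ξ z t (epoch η t))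
  then epochSet R α η h g ξ z t (prevEpoch η t)
  else epochSet R α η h g ξ z t (epoch η t)

/-! ### The oracle -/

/-- `q*_β`, the `(1-β)`-quantile of `R(Z; ξ*)` for `Z ∼ μ`. -/
def oracleQuantile (μ : Measure 𝒵) (R : 𝒵 → Ξ → ℝ) (ξs : Ξ) (β : EReal) : EReal :=
  genInv (fun r => μ.real {z | R z ξs ≤ r}) (1 - β)

/-- `C*_α = {z : R(z; ξ*) ≤ q*_α}`. -/
def oracleSet (μ : Measure 𝒵) (R : 𝒵 → Ξ → ℝ) (ξs : Ξ) (α : ℝ) : Set 𝒵 :=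
  {z | ((R z ξs : ℝ) : EReal) ≤ oracleQuantile μ R ξs (α : EReal)}

/-- `g(ε) = L {z : |R(z; ξ*) - q*_α| < ε}`. -/
def shellSize (L μ : Measure 𝒵) (R : 𝒵 → Ξ → ℝ) (ξs : Ξ) (α : ℝ) (ε : ℝ≥0∞) : ℝ≥0∞ :=
  L {z | (((R z ξs : ℝ) : EReal) - oracleQuantile μ R ξs (α : EReal)).abs < ε}

/-- `ḡ(ε) = L {z : |R(z; ξ*) - q*_α| ≤ ε}`. -/
def closedShellSize (L μ : Measure 𝒵) (R : 𝒵 → Ξ → ℝ) (ξs : Ξ) (α : ℝ) (ε : ℝ≥0∞) : ℝ≥0∞ :=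
  L {z | (((R z ξs : ℝ) : EReal) - oracleQuantile μ R ξs (α : EReal)).abs ≤ ε}

/-- `√(η log(2/κ) / (2 t (η - 1)))`. -/
def samplingError (η κ : ℝ) (t : ℕ) : ℝ :=
  √(η * Real.log (2 / κ) / (2 * (t : ℝ) * (η - 1)))

/-- `max_{ω ∈ {1, -1}} |q*_α - q*_{α - u + ω e}|`. -/
def quantilePerturbation (μ : Measure 𝒵) (R : 𝒵 → Ξ → ℝ) (ξs : Ξ) (α : ℝ) (u : EReal) (e : ℝ) :
    ℝ≥0∞ :=
  max (oracleQuantile μ R ξs (α : EReal) -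
        oracleQuantile μ R ξs ((α : EReal) - u + (e : EReal))).abs
      (oracleQuantile μ R ξs (α : EReal) -
        oracleQuantile μ R ξs ((α : EReal) - u + ((-e : ℝ) : EReal))).abs

end Sets

/-- `X_t = O_ℙ(1)` as `t → ∞`, for nonnegative extended-real sequences. -/
def BoundedInProbability {Ω : Type*} [MeasurableSpace Ω] (P : Measure Ω)
    (X : ℕ → Ω → ℝ≥0∞) : Prop :=
  ∀ κ : ℝ≥0∞, 0 < κ → ∃ M : ℝ≥0, ∀ᶠ t in atTop, P {ω | (M : ℝ≥0∞) < X t ω} ≤ κ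

/-- Near `x`, the measure `ν` has a Lebesgue density, and it is bounded away from zero. -/
def DensityBoundedBelowNear (ν : Measure ℝ) (x : ℝ) : Prop :=
  ∃ (f : ℝ → ℝ≥0∞) (δ : ℝ) (c : ℝ≥0∞), Measurable f ∧ 0 < δ ∧ 0 < c ∧
    ν.restrict (Set.Ioo (x - δ) (x + δ)) =
      (volume.restrict (Set.Ioo (x - δ) (x + δ))).withDensity f ∧
    ∀ y ∈ Set.Ioo (x - δ) (x + δ), c ≤ f y

/-- `G(ε) ≍ ε` as `ε → 0+`. -/
def LinearNearZero (G : ℝ≥0∞ → ℝ≥0∞) : Prop :=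
  ∃ a b : ℝ≥0, 0 < a ∧ ∃ ε₀ : ℝ≥0, 0 < ε₀ ∧ ∀ ε : ℝ≥0, 0 < ε → ε ≤ ε₀ →
    (a : ℝ≥0∞) * ε ≤ G ε ∧ G ε ≤ (b : ℝ≥0∞) * ε

end

end OnlineTUC

namespace OnlineTUC

/-! The reported set is the smaller of two candidates, so it is enough to bound the one from the
preceding epoch `j`, whose calibration sample has size `s ≥ t (η - 1) / η`
(`mul_le_calSize_prevEpoch`).

By the Lipschitz condition, replacing the estimate by `ξ*` in every calibration score moves the
empirical quantile by at most `D = d(ξ*, ξ̂)`, whatever the dependence of the estimate on the data.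
What remains is a statement about i.i.d. oracle scores with distribution function `F`. Let `q` be
the oracle quantile at the raised level `1 - α + u + e`, with `e` the sampling error. Then `F q ≥ 1
- α + u + e`, and one binomial tail bound at the single point `q` shows that the rescaled empirical
distribution function reaches `1 - α + u` at `q`, except with probability at most `2 exp(-2 s e²) ≤
κ`. Off this event the empirical quantile is at most `q + D`. Returning from `ξ̂` to `ξ*` costs
another `D`, so the set lies in `{R(·; ξ*) ≤ q + 2D}`, hence in the oracle set together with a shell
of radius `2D + |q* - q|`. For continuous `F` the same tail bound produces a point strictly below
`q`, which opens the shell.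

The rescaling `s / (s + 1)` makes Hoeffding's inequality slightly too weak. The loss is absorbed by
the factor `2` in the tail bound, through a sharpening of Pinsker's inequality
(`bernoulli_kl_lower_bound`, `two_mul_sq_le_log_two_add`).

For the rate, a density bounded below makes the oracle quantile locally Lipschitz in its level
(`genInv_stable`), and the shell size is at most linear in its radius. -/

/-! ### A binomial tail bound -/

/-- A refinement of Pinsker's inequality for two Bernoulli laws. -/
theorem bernoulli_kl_lower_bound {a θ : ℝ} (ha0 : 0 ≤ a) (haθ : a ≤ θ) (hθ1 : θ < 1) :
    2 * (θ - a) ^ 2 + 2 * (θ - a) ^ 2 * (4 * (θ - a) / 3 + 2 * a - 1) ^ 2 ≤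
      a * Real.log a + (1 - a) * Real.log (1 - a) - a * Real.log θ
        - (1 - a) * Real.log (1 - θ) := by
  -- The subtracted quartic is the integral of `4 (z - a) (1 + (1 - 2z)²)` from `a` to `y`. At `y =
  -- θ` it exceeds the stated lower bound by `4/9 (θ - a)⁴`, which is dropped at the end to complete
  -- a square.
  set ψ : ℝ → ℝ := fun y => (- a * Real.log y - (1 - a) * Real.log (1 - y))
    - (2 * (y - a) ^ 2 + 2 * (1 - 2 * a) ^ 2 * (y - a) ^ 2
        - 16 * (1 - 2 * a) * (y - a) ^ 3 / 3 + 4 * (y - a) ^ 4) with hψ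
  have hcont : ContinuousOn ψ (Set.Icc a θ) := by
    have h1 : ContinuousOn (fun y : ℝ => - a * Real.log y) (Set.Icc a θ) := by
      rcases ha0.eq_or_lt with h | h
      · simp only [← h, neg_zero, zero_mul]; exact continuousOn_const
      · refine continuousOn_const.mul (continuousOn_id.log ?_)
        intro y hy; exact (h.trans_le hy.1).ne'
    have h2 : ContinuousOn (fun y : ℝ => (1 - a) * Real.log (1 - y)) (Set.Icc a θ) := by
      refine continuousOn_const.mul (ContinuousOn.log (by fun_prop) ?_)
      intro y hy; linarith [hy.2]
    exact (h1.sub h2).sub (by fun_prop)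
  have hmono : MonotoneOn ψ (Set.Icc a θ) := by
    refine monotoneOn_of_hasDerivWithinAt_nonneg (convex_Icc a θ) hcont
      (f' := fun y => (- a * y⁻¹ + (1 - a) * (1 - y)⁻¹)
        - (4 * (y - a) + 4 * (y - a) * (1 - 2 * y) ^ 2)) ?_ ?_
    · intro y hy
      rw [interior_Icc] at hy
      have hy0 : y ≠ 0 := (ha0.trans_lt hy.1).ne'
      have hy1 : 1 - y ≠ 0 := by linarith [hy.2]
      have d1 : HasDerivAt (fun y : ℝ => Real.log (1 - y)) (-1 / (1 - y)) y :=
        ((hasDerivAt_id y).const_sub 1).log hy1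
      have d0 : HasDerivAt (fun y : ℝ => y - a) 1 y := (hasDerivAt_id y).sub_const a
      have d := (((Real.hasDerivAt_log hy0).const_mul (-a)).sub (d1.const_mul (1 - a))).sub
        (((((d0.pow 2).const_mul 2).add ((d0.pow 2).const_mul (2 * (1 - 2 * a) ^ 2))).sub
          (((d0.pow 3).const_mul (16 * (1 - 2 * a))).div_const 3)).add ((d0.pow 4).const_mul 4))
      refine HasDerivAt.hasDerivWithinAt (d.congr_deriv ?_)
      simp only [div_eq_mul_inv]
      push_cast
      ring
    · intro y hy
      rw [interior_Icc] at hy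
      have hy0 : 0 < y := ha0.trans_lt hy.1
      have hy1 : 0 < 1 - y := by linarith [hy.2]
      -- From `1 = 4y(1 - y) + (1 - 2y)²`, applied twice, `1/(y(1 - y)) = 4 + 4(1 - 2y)² + (1 -
      -- 2y)⁴/(y(1 - y))`.
      have e : (- a * y⁻¹ + (1 - a) * (1 - y)⁻¹)
        - (4 * (y - a) + 4 * (y - a) * (1 - 2 * y) ^ 2)
          = (y - a) * (1 - 2 * y) ^ 4 / (y * (1 - y)) := by
        field_simp
        ring
      show 0 ≤ _
      rw [e]
      have := hy.1
      have : 0 ≤ y - a := by linarith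
      positivity
  have h := hmono (Set.left_mem_Icc.2 haθ) (Set.right_mem_Icc.2 haθ) haθ
  simp only [hψ] at h
  have : 0 ≤ (θ - a) ^ 4 := by positivity
  nlinarith [h]

/-- Compensation of the factor `s / (s + 1)` in front of the empirical distribution function by
the factor `2` in front of the tail bound. -/
theorem two_mul_sq_le_log_two_add {s a x : ℝ} (hs : 1 ≤ s) (ha0 : 0 ≤ a) (hx0 : 0 ≤ x)
    (hax : a + x ≤ 1) :
    2 * s * (x + a / (s + 1)) ^ 2 ≤
      Real.log 2 + s * (2 * x ^ 2 + 2 * x ^ 2 * (4 * x / 3 + 2 * a - 1) ^ 2) := by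
  have hs1 : 0 < s + 1 := by linarith
  obtain ⟨m, hm⟩ : ∃ m : ℝ, m = 1 / (s + 1) := ⟨_, rfl⟩
  have hms : m * (s + 1) = 1 := by rw [hm]; field_simp
  have hm0 : 0 < m := by rw [hm]; positivity
  have hm2 : m ≤ 1 / 2 := by nlinarith
  have hsm : s * m = 1 - m := by linarith
  -- This is what is left once `hsq` has linearised the extra square (its cross term cancels `4 x a
  -- (1 - m)`) and `a` has been replaced by `1 - x`. With `A + m B` for the bracket, AM-GM in `m`
  -- gives at most `(A + B)² / (4 B)`; note `2.76 = 4 * 0.69` and `0.69 < log 2`.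
  have key : (1 - m) * ((2 * x - 8 * x ^ 2 / 3) + m * (1 / 2 + 2 * (1 - x) ^ 2)) ≤ 0.69 := by
    have hx1 : x ≤ 1 := by linarith
    obtain ⟨B, hB⟩ : ∃ B, B = 1 / 2 + 2 * (1 - x) ^ 2 := ⟨_, rfl⟩
    obtain ⟨A, hA⟩ : ∃ A, A = 2 * x - 8 * x ^ 2 / 3 := ⟨_, rfl⟩
    rw [← hA, ← hB]
    have hBp : 0 < B := by rw [hB]; positivity
    have h1 : (A + B) ^ 2 ≤ 2.76 * B := by
      have h3 : 0 ≤ x ^ 2 * (1 - x) := mul_nonneg (sq_nonneg x) (by linarith)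
      have h4 : 0 ≤ x ^ 2 * (1 - x) * (1 + x) := mul_nonneg h3 (by linarith)
      have h5 : (0 : ℝ) ≤ (x - 3 / 10) ^ 2 := sq_nonneg _
      rw [hA, hB]
      linarith [h3, h4, h5, sq_nonneg x]
    have h2 : 4 * (B * ((1 - m) * (A + m * B))) ≤ (A + B) ^ 2 := by
      linarith [sq_nonneg (B - m * B - (A + m * B))]
    by_contra hc
    push Not at hc
    linarith [mul_lt_mul_of_pos_left hc hBp]
  have ham : a / (s + 1) = a * m := by rw [hm]; ring
  rw [ham]
  have hl := Real.log_two_gt_d9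
  have ha2 : a ^ 2 ≤ (1 - x) ^ 2 := by nlinarith
  have hsq : 0 ≤ s * (x * (4 * x / 3 + 2 * a - 1) - m / 2) ^ 2 := by positivity
  have e1 : 2 * s * (x + a * m) ^ 2
      = 2 * s * x ^ 2 + 4 * x * a * (1 - m) + 2 * a ^ 2 * m * (1 - m) := by
    rw [← hsm]; ring
  have e2 : 2 * (s * (x * (4 * x / 3 + 2 * a - 1) - m / 2) ^ 2)
      = 2 * s * x ^ 2 * (4 * x / 3 + 2 * a - 1) ^ 2
        - 2 * (1 - m) * x * (4 * x / 3 + 2 * a - 1) + m * (1 - m) / 2 := by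
    rw [← hsm]; ring
  have h3 : a ^ 2 * (m * (1 - m)) ≤ (1 - x) ^ 2 * (m * (1 - m)) :=
    mul_le_mul_of_nonneg_right ha2 (by nlinarith)
  linarith [h3, e1, e2, hsq, key]

/-- The optimised Chernoff bound for a binomial variable `N` with parameters `s`, `θ`, where `π`
stands for `P (N ≤ j)`. -/
theorem le_two_mul_exp_of_forall_pow {s j : ℕ} (hs : 1 ≤ s) (hj : j ≤ s) {θ π : ℝ} (hθ1 : θ ≤ 1)
    (hθ : (j : ℝ) / (s + 1) ≤ θ) (hπ1 : π ≤ 1)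
    (hπ : ∀ w : ℝ, 0 ≤ w → w ≤ 1 → π * w ^ j ≤ (1 - θ + θ * w) ^ s) :
    π ≤ 2 * Real.exp (-2 * s * (θ - j / (s + 1)) ^ 2) := by
  have hs' : (1 : ℝ) ≤ s := by exact_mod_cast hs
  have hjs : (j : ℝ) ≤ s := by exact_mod_cast hj
  have hs1 : (0 : ℝ) < (s : ℝ) + 1 := by linarith
  set a : ℝ := j / s with ha
  have ha0 : 0 ≤ a := by positivity
  have ha1 : a ≤ 1 := by rw [ha, div_le_one (by linarith)]; exact hjs
  have hjas : (j : ℝ) = a * s := by rw [ha]; field_simp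
  have hsplit : θ - j / (s + 1) = (θ - a) + a / (s + 1) := by
    rw [hjas]; field_simp; ring
  have hl := Real.log_two_gt_d9
  have two_exp : ∀ y : ℝ, 2 * Real.exp y = Real.exp (Real.log 2 + y) := by
    intro y; rw [Real.exp_add, Real.exp_log two_pos]
  rw [two_exp]
  rcases le_or_gt θ a with hle | hlt
  -- Here the deviation is at most `1 / (s + 1)`, so the exponent costs at most `1/2 < log 2` and
  -- the claimed bound is at least `1`.
  · refine hπ1.trans (Real.one_le_exp ?_)
    have h1 : θ - j / (s + 1) ≤ 1 / (s + 1) := by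
      rw [hsplit]
      have : a / ((s : ℝ) + 1) ≤ 1 / (s + 1) := by gcongr
      linarith
    have h2 : (θ - j / (s + 1)) ^ 2 ≤ (1 / ((s : ℝ) + 1)) ^ 2 :=
      pow_le_pow_left₀ (by linarith) h1 2
    have h3 : (s : ℝ) * (1 / ((s : ℝ) + 1)) ^ 2 ≤ 1 / 4 := by
      rw [div_pow, one_pow, mul_one_div, div_le_div_iff₀ (by positivity) (by norm_num)]
      nlinarith [sq_nonneg ((s : ℝ) - 1)]
    nlinarith
  have hsmall : 2 * s * (θ - j / (s + 1)) ^ 2 ≤ Real.log 2 + s * (2 * (θ - a) ^ 2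
      + 2 * (θ - a) ^ 2 * (4 * (θ - a) / 3 + 2 * a - 1) ^ 2) := by
    rw [hsplit]
    exact two_mul_sq_le_log_two_add hs' ha0 (by linarith) (by linarith)
  rcases hθ1.eq_or_lt with h1 | h1
  · have hjlt : j < s := by
      have : (j : ℝ) < s := by rw [hjas]; nlinarith
      exact_mod_cast this
    -- For `θ = 1` the optimal `w` degenerates to `0`. A small positive `w` still gives `π ≤ w ^ (s
    -- - j) ≤ w`.
    have hw := hπ (Real.exp (-2 * s)) (Real.exp_pos _).le (Real.exp_le_one_iff.2 (by nlinarith))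
    rw [h1, sub_self, zero_add, one_mul] at hw
    have h5 : π ≤ Real.exp (-2 * s) := by
      have hp : 0 < Real.exp (-2 * s) ^ j := by positivity
      have h6 : Real.exp (-2 * s) ^ s ≤ Real.exp (-2 * s) ^ (j + 1) :=
        pow_le_pow_of_le_one (Real.exp_pos _).le (Real.exp_le_one_iff.2 (by nlinarith)) hjlt
      rw [pow_succ'] at h6
      exact le_of_mul_le_mul_right (hw.trans h6) hp
    refine h5.trans (Real.exp_le_exp.2 ?_)
    have h7 : θ - j / (s + 1) ≤ 1 := by
      have : 0 ≤ (j : ℝ) / (s + 1) := by positivity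
      linarith
    have h8 : (θ - j / (s + 1)) ^ 2 ≤ 1 := pow_le_one₀ (by linarith) h7
    nlinarith
  have hθ0 : 0 < θ := ha0.trans_lt hlt
  have h1θ : 0 < 1 - θ := by linarith
  have h1a : 0 < 1 - a := by linarith
  have hKL := bernoulli_kl_lower_bound ha0 hlt.le h1
  -- The minimiser of `(1 - θ + θ w) ^ s / w ^ j`; the minimum is `exp(-s · KL(a ‖ θ))`.
  set w : ℝ := a * (1 - θ) / (θ * (1 - a)) with hw
  have hw0 : 0 ≤ w := by positivity
  have hw1 : w ≤ 1 := by rw [hw, div_le_one (by positivity)]; nlinarith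
  have hval : 1 - θ + θ * w = (1 - θ) / (1 - a) := by rw [hw]; field_simp; ring
  have hb := hπ w hw0 hw1
  rw [hval] at hb
  have hpow : ((1 - θ) / (1 - a)) ^ s
      = Real.exp (s * (Real.log (1 - θ) - Real.log (1 - a))) := by
    rw [← Real.log_div h1θ.ne' h1a.ne', Real.exp_nat_mul, Real.exp_log (by positivity)]
  have hwj : w ^ j = Real.exp (s * (a * (Real.log a + Real.log (1 - θ) - Real.log θ
      - Real.log (1 - a)))) := by
    rcases Nat.eq_zero_or_pos j with h0 | h0
    · have : a = 0 := by rw [ha, h0]; simp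
      rw [h0, this]; simp
    · have hap : 0 < a := by rw [ha]; positivity
      have hwp : 0 < w := by positivity
      have hlw : Real.log w = Real.log a + Real.log (1 - θ) - Real.log θ - Real.log (1 - a) := by
        rw [hw, Real.log_div (by positivity) (by positivity),
          Real.log_mul hap.ne' h1θ.ne', Real.log_mul hθ0.ne' h1a.ne']
        ring
      rw [← hlw, ← mul_assoc, mul_comm (s : ℝ) a, ← hjas, Real.exp_nat_mul, Real.exp_log hwp]
  rw [hpow, hwj, ← le_div_iff₀ (Real.exp_pos _), ← Real.exp_sub] at hb
  refine hb.trans (Real.exp_le_exp.2 ?_)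
  have hKs := mul_le_mul_of_nonneg_left hKL (by linarith : (0 : ℝ) ≤ s)
  linarith

/-- Lower tail of an empirical frequency rescaled by `s / (s + 1)`, where `s` is the sample size. -/
theorem measure_sum_indicator_lt_le {ι Ω 𝒵 : Type*} [MeasurableSpace Ω] [MeasurableSpace 𝒵]
    {P : Measure Ω} [IsProbabilityMeasure P] (T : Finset ι) (hT : 1 ≤ T.card)
    {X : ι → Ω → 𝒵} (hX : ∀ i, Measurable (X i)) (hind : iIndepFun X P)
    {A : Set 𝒵} (hA : MeasurableSet A) {θ : ℝ} (hθ : ∀ i, P.real (X i ⁻¹' A) = θ)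
    {p e : ℝ} (he : 0 ≤ e) (hp : p + e ≤ θ) :
    P {ω | ∑ i ∈ T, A.indicator (fun _ => (1 : ℝ)) (X i ω) < ((T.card : ℝ) + 1) * p} ≤
      ENNReal.ofReal (2 * Real.exp (-2 * T.card * e ^ 2)) := by
  classical
  rcases le_or_gt p 0 with hp0 | hp0
  · have : {ω | ∑ i ∈ T, A.indicator (fun _ => (1 : ℝ)) (X i ω) < ((T.card : ℝ) + 1) * p} = ∅ := by
      ext ω
      simp only [Set.mem_ofPred_eq, Set.mem_empty_iff_false, iff_false, not_lt]
      refine (mul_nonpos_of_nonneg_of_nonpos (by positivity) hp0).trans ?_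
      exact Finset.sum_nonneg fun i _ => Set.indicator_nonneg (fun _ _ => zero_le_one) _
    rw [this]; simp
  obtain ⟨i₀, hi₀⟩ : T.Nonempty := Finset.card_pos.1 hT
  have hθ1 : θ ≤ 1 := by rw [← hθ i₀]; exact measureReal_le_one
  have hθ0 : 0 ≤ θ := by linarith
  set s := T.card with hs
  -- The largest integer strictly below `(s + 1) p`, so that the event says that the count is at
  -- most `j`. Since `p ≤ θ ≤ 1`, also `j ≤ s`.
  set j := ⌈((s : ℝ) + 1) * p⌉₊ - 1 with hj
  have hcpos : 0 < ⌈((s : ℝ) + 1) * p⌉₊ := Nat.ceil_pos.2 (by positivity)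
  have hjlt : (j : ℝ) < ((s : ℝ) + 1) * p := Nat.lt_ceil.1 (by omega)
  have hjs : j ≤ s := by
    have : ⌈((s : ℝ) + 1) * p⌉₊ ≤ s + 1 := by
      rw [Nat.ceil_le]; push_cast; nlinarith
    omega
  set E := {ω | ∑ i ∈ T, A.indicator (fun _ => (1 : ℝ)) (X i ω) < ((s : ℝ) + 1) * p} with hE
  have hpow : ∀ w : ℝ, 0 ≤ w → w ≤ 1 → P.real E * w ^ j ≤ (1 - θ + θ * w) ^ s := by
    intro w hw0 hw1
    set φ : 𝒵 → ℝ≥0∞ := fun x => if x ∈ A then ENNReal.ofReal w else 1 with hφ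
    have hφm : Measurable φ := Measurable.ite hA measurable_const measurable_const
    have hprod : ∀ ω, ∏ i ∈ T, φ (X i ω)
        = ENNReal.ofReal w ^ (T.filter (fun i => X i ω ∈ A)).card := by
      intro ω
      rw [hφ, Finset.prod_ite, Finset.prod_const, Finset.prod_const_one, mul_one]
    have hint : ∫⁻ ω, ∏ i ∈ T, φ (X i ω) ∂P = ENNReal.ofReal ((1 - θ + θ * w) ^ s) := by
      have h1 := lintegral_prod_eq_prod_lintegral_of_indepFun T (fun i ω => φ (X i ω))
        (hind.comp (fun _ => φ) (fun _ => hφm)) (fun i => hφm.comp (hX i))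
      rw [h1]
      have h2 : ∀ i, ∫⁻ ω, φ (X i ω) ∂P = ENNReal.ofReal (1 - θ + θ * w) := by
        intro i
        have hm : MeasurableSet (X i ⁻¹' A) := hX i hA
        rw [← lintegral_add_compl _ hm,
          setLIntegral_congr_fun (g := fun _ => ENNReal.ofReal w) hm
            (fun ω hω => by simp only [hφ]; exact if_pos hω),
          setLIntegral_congr_fun (g := fun _ => 1) hm.compl
            (fun ω hω => by simp only [hφ]; exact if_neg hω),
          setLIntegral_const, setLIntegral_const, one_mul, ← ofReal_measureReal,
          ← ofReal_measureReal, probReal_compl_eq_one_sub hm, hθ i,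
          ← ENNReal.ofReal_mul hw0, ← ENNReal.ofReal_add (by positivity) (by linarith)]
        congr 1; ring
      rw [Finset.prod_congr rfl (fun i _ => h2 i), Finset.prod_const, ENNReal.ofReal_pow]
      nlinarith
    -- The product equals `w` to the power of the count, and `w ≤ 1`: few hits mean a large product,
    -- and Markov's inequality applies.
    have hsub : E ⊆ {ω | ENNReal.ofReal w ^ j ≤ ∏ i ∈ T, φ (X i ω)} := by
      intro ω hω
      have hcard : ∑ i ∈ T, A.indicator (fun _ => (1 : ℝ)) (X i ω)
          = ((T.filter (fun i => X i ω ∈ A)).card : ℝ) := by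
        simp only [Set.indicator_apply]
        rw [Finset.sum_boole]
      have hω' : ∑ i ∈ T, A.indicator (fun _ => (1 : ℝ)) (X i ω) < ((s : ℝ) + 1) * p := hω
      rw [hcard] at hω'
      have := Nat.lt_ceil.2 hω'
      show ENNReal.ofReal w ^ j ≤ ∏ i ∈ T, φ (X i ω)
      rw [hprod]
      exact pow_le_pow_of_le_one zero_le (ENNReal.ofReal_le_one.2 hw1) (by omega)
    have hmeas : Measurable fun ω => ∏ i ∈ T, φ (X i ω) :=
      Finset.measurable_fun_prod _ fun i _ => hφm.comp (hX i)
    have h3 := mul_meas_ge_le_lintegral (μ := P) hmeas (ENNReal.ofReal w ^ j)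
    have h4 : ENNReal.ofReal w ^ j * P E ≤ ENNReal.ofReal ((1 - θ + θ * w) ^ s) := by
      rw [← hint]; exact (mul_le_mul_right (measure_mono hsub) _).trans h3
    rw [← ofReal_measureReal (μ := P) (s := E), ← ENNReal.ofReal_pow hw0,
      ← ENNReal.ofReal_mul (by positivity), ENNReal.ofReal_le_ofReal_iff] at h4
    · linarith
    · have : 0 ≤ 1 - θ + θ * w := by nlinarith
      positivity
  have hjp : (j : ℝ) / (s + 1) ≤ p := by
    rw [div_le_iff₀ (by positivity)]; linarith
  have hmain := le_two_mul_exp_of_forall_pow hT hjs hθ1 (by linarith) measureReal_le_one hpow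
  rw [← ofReal_measureReal (μ := P) (s := E)]
  refine ENNReal.ofReal_le_ofReal (hmain.trans ?_)
  have h5 : e ^ 2 ≤ (θ - j / (s + 1)) ^ 2 := pow_le_pow_left₀ he (by linarith) 2
  have h6 : (0 : ℝ) ≤ s := by positivity
  have h7 := mul_le_mul_of_nonneg_left h5 h6
  refine mul_le_mul_of_nonneg_left (Real.exp_le_exp.2 ?_) two_pos.le
  linarith

/-! ### Generalised inverses -/

theorem genInv_le {F : ℝ → ℝ} {p : EReal} {x : ℝ} (hx : p ≤ ((F x : ℝ) : EReal)) :
    genInv F p ≤ (x : EReal) :=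
  sInf_le ⟨x, rfl, hx⟩

theorem le_genInv {F : ℝ → ℝ} {p : EReal} {q : EReal}
    (hq : ∀ x : ℝ, p ≤ ((F x : ℝ) : EReal) → q ≤ (x : EReal)) : q ≤ genInv F p :=
  le_sInf (by rintro _ ⟨x, rfl, hx⟩; exact hq x hx)

theorem genInv_top (F : ℝ → ℝ) : genInv F ⊤ = ⊤ :=
  top_le_iff.1 (le_genInv fun _ hx => absurd (top_le_iff.1 hx) (EReal.coe_ne_top _))

/-- Right continuity makes the infimum attained: `F < p` at `q` would persist just to the right of
`q`. -/
theorem le_apply_of_genInv_eq {F : ℝ → ℝ} (hF : Monotone F)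
    (hc : ∀ x, ContinuousWithinAt F (Set.Ici x) x) {p q : ℝ}
    (h : genInv F (p : EReal) = (q : EReal)) : p ≤ F q := by
  by_contra hlt
  push Not at hlt
  have h1 : ∀ᶠ y in 𝓝[>] q, F y < p :=
    ((hc q).mono Set.Ioi_subset_Ici_self).eventually (gt_mem_nhds hlt)
  obtain ⟨y, hy, hqy⟩ := (h1.and self_mem_nhdsWithin).exists
  have h2 : (y : EReal) ≤ genInv F (p : EReal) := le_genInv fun x hx => by
    have hx' : p ≤ F x := by exact_mod_cast hx
    have : y < x := by
      by_contra hxy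
      exact absurd (hF (not_lt.1 hxy)) (by linarith)
    exact_mod_cast this.le
  rw [h] at h2
  have : y ≤ q := by exact_mod_cast h2
  exact absurd this (not_le.2 hqy)

theorem lt_of_lt_genInv {F : ℝ → ℝ} {p q y : ℝ} (h : genInv F (p : EReal) = (q : EReal))
    (hy : y < q) : F y < p := by
  by_contra hle
  have h1 : genInv F (p : EReal) ≤ (y : EReal) := genInv_le (by exact_mod_cast not_lt.1 hle)
  rw [h] at h1
  exact absurd (by exact_mod_cast h1) (not_le.2 hy)

theorem exists_genInv_eq_coe {F : ℝ → ℝ} {p a b : ℝ} (hF : Monotone F) (ha : F a < p)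
    (hb : p ≤ F b) : ∃ q : ℝ, genInv F (p : EReal) = (q : EReal) := by
  have h1 : genInv F (p : EReal) ≤ (b : EReal) := genInv_le (by exact_mod_cast hb)
  have h2 : (a : EReal) ≤ genInv F (p : EReal) := le_genInv fun x hx => by
    have hx' : p ≤ F x := by exact_mod_cast hx
    by_contra hxa
    have : x ≤ a := by exact_mod_cast (not_le.1 hxa).le
    exact absurd (hF this) (by linarith)
  refine ⟨(genInv F (p : EReal)).toReal, (EReal.coe_toReal ?_ ?_).symm⟩
  · exact ne_top_of_le_ne_top (EReal.coe_ne_top b) h1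
  · exact ne_bot_of_le_ne_bot (EReal.coe_ne_bot a) h2

/-- If `F` grows at least at rate `c` near its `p`-quantile, the quantile is locally Lipschitz. -/
theorem genInv_stable {F : ℝ → ℝ} (hF : Monotone F)
    (hc : ∀ x, ContinuousWithinAt F (Set.Ici x) x) {p q c δ : ℝ} (hc0 : 0 < c)
    (h : genInv F (p : EReal) = (q : EReal))
    (hgrow : ∀ a b, q - δ < a → a ≤ b → b < q + δ → c * (b - a) ≤ F b - F a)
    {v : ℝ} (hv : |v| < c * δ) :
    ∃ q' : ℝ, genInv F ((p + v : ℝ) : EReal) = (q' : EReal) ∧ |q - q'| ≤ |v| / c := by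
  obtain ⟨x, hx⟩ : ∃ x, x = |v| / c := ⟨_, rfl⟩
  have hcx : c * x = |v| := by rw [hx]; field_simp
  have hx0 : 0 ≤ x := by rw [hx]; positivity
  have hxδ : x < δ := by
    by_contra hle
    exact absurd (mul_le_mul_of_nonneg_left (not_lt.1 hle) hc0.le) (by linarith)
  have hpq := le_apply_of_genInv_eq hF hc h
  have hup : p + v ≤ F (q + x) := by
    have := hgrow q (q + x) (by linarith) (by linarith) (by linarith)
    have h2 := le_abs_self v
    linarith
  have hlow : ∀ r, r < q - x → F r < p + v := by
    intro r hr
    -- Only `F y < p` for `y < q` is available, since `F q` itself may exceed `p`; hence the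
    -- comparison point `y` lies strictly left of `q`. The maximum keeps the lower point inside the
    -- window where `F` is known to grow.
    obtain ⟨y, hy1, hy2⟩ : ∃ y, max r (q - (x + δ) / 2) + x < y ∧ y < q := by
      apply exists_between
      rw [← lt_sub_iff_add_lt, max_lt_iff]
      constructor <;> linarith
    set r' := max r (q - (x + δ) / 2) with hr'
    have h1 : F r ≤ F r' := hF (le_max_left _ _)
    have h2 : q - (x + δ) / 2 ≤ r' := le_max_right _ _
    have h3 := hgrow r' y (by linarith) (by linarith) (by linarith)
    have h4 := lt_of_lt_genInv h hy2
    have h5 : c * x < c * (y - r') := by gcongr; linarith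
    have h6 := neg_abs_le v
    linarith
  have hle : genInv F ((p + v : ℝ) : EReal) ≤ ((q + x : ℝ) : EReal) :=
    genInv_le (by exact_mod_cast hup)
  obtain ⟨q', hq'⟩ := exists_genInv_eq_coe hF (hlow (q - x - 1) (by linarith)) hup
  refine ⟨q', hq', ?_⟩
  rw [hq'] at hle
  have h7 : q' ≤ q + x := by exact_mod_cast hle
  have h8 : q - x ≤ q' := by
    by_contra hlt
    exact absurd (le_apply_of_genInv_eq hF hc hq') (not_le.2 (hlow q' (not_le.1 hlt)))
  rw [← hx, abs_le]
  constructor <;> linarith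

/-! ### The oracle quantile -/

section Oracle

variable {𝒵 Ξ : Type*} [MeasurableSpace 𝒵]

theorem real_le_eq_cdf {μ : Measure 𝒵} [IsProbabilityMeasure μ] {f : 𝒵 → ℝ} (hf : Measurable f)
    (r : ℝ) : μ.real {z | f z ≤ r} = cdf (μ.map f) r := by
  have : IsProbabilityMeasure (μ.map f) := Measure.isProbabilityMeasure_map hf.aemeasurable
  rw [cdf_eq_real, map_measureReal_apply hf measurableSet_Iic]
  rfl

theorem oracleQuantile_eq_genInv_cdf {μ : Measure 𝒵} [IsProbabilityMeasure μ] {R : 𝒵 → Ξ → ℝ}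
    {ξs : Ξ} (hR : Measurable (fun z => R z ξs)) (β : EReal) :
    oracleQuantile μ R ξs β = genInv (cdf (μ.map fun z => R z ξs)) (1 - β) := by
  unfold oracleQuantile
  congr 1
  funext r
  exact real_le_eq_cdf hR r

theorem exists_oracleQuantile_eq_coe {μ : Measure 𝒵} [IsProbabilityMeasure μ] {R : 𝒵 → Ξ → ℝ}
    {ξs : Ξ} (hR : Measurable (fun z => R z ξs)) {α : ℝ} (hα0 : 0 < α) (hα1 : α < 1) :
    ∃ q : ℝ, oracleQuantile μ R ξs (α : EReal) = (q : EReal) := by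
  rw [oracleQuantile_eq_genInv_cdf hR]
  obtain ⟨a, ha⟩ := ((tendsto_cdf_atBot (μ.map fun z => R z ξs)).eventually
    (gt_mem_nhds (by linarith : (0 : ℝ) < 1 - α))).exists
  obtain ⟨b, hb⟩ := ((tendsto_cdf_atTop (μ.map fun z => R z ξs)).eventually
    (lt_mem_nhds (by linarith : 1 - α < (1 : ℝ)))).exists
  obtain ⟨q, hq⟩ := exists_genInv_eq_coe (monotone_cdf _) ha hb.le
  exact ⟨q, by rw [← hq]; norm_cast⟩

end Oracle

/-! ### The empirical quantile -/

/-- The rescaled empirical distribution function `s / (s + 1) · F̂`. -/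
noncomputable def scaledCDF (η : ℝ) (t k : ℕ) (x : ℕ → ℝ) (r : ℝ) : ℝ :=
  (calSize η t k : ℝ) / ((calSize η t k : ℝ) + 1) * empCDF η t k x r

theorem scaledCDF_le_of_dist_le {η : ℝ} {t k : ℕ} {x y : ℕ → ℝ} {D : ℝ}
    (hxy : ∀ s, x s ≤ y s + D) (r : ℝ) :
    scaledCDF η t k y r ≤ scaledCDF η t k x (r + D) := by
  unfold scaledCDF empCDF
  gcongr with s _
  simp only [Set.indicator_apply, Set.mem_Iic]
  have := hxy s
  split_ifs with h1 h2 <;> linarith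

theorem calQuantile_le_of_dist_le {α η : ℝ} {t k : ℕ} {u : EReal} {x y : ℕ → ℝ} {D r : ℝ}
    (hxy : ∀ s, x s ≤ y s + D)
    (hr : ((1 - α : ℝ) : EReal) + u ≤ ((scaledCDF η t k y r : ℝ) : EReal)) :
    calQuantile α η t k u x ≤ ((r + D : ℝ) : EReal) := by
  refine genInv_le (hr.trans ?_)
  exact EReal.coe_le_coe_iff.2 (scaledCDF_le_of_dist_le hxy r)

theorem one_le_natCeil_pow {η : ℝ} (hη : 1 < η) (k : ℕ) : 1 ≤ ⌈η ^ k⌉₊ :=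
  Nat.ceil_pos.2 (by positivity)

/-- The calibration sample of the preceding epoch makes up a fraction `1 - 1 / η` of the data. -/
theorem mul_le_calSize_prevEpoch {η : ℝ} (hη : 1 < η) {t : ℕ} (ht : 1 ≤ t) :
    (t : ℝ) * (η - 1) ≤ η * calSize η t (prevEpoch η t) ∧ 1 ≤ calSize η t (prevEpoch η t) := by
  have hη0 : 0 < η := by linarith
  have ht' : (1 : ℝ) ≤ t := by exact_mod_cast ht
  obtain ⟨hle, -⟩ := epoch_spec hη ht
  unfold calSize prevEpoch
  -- In epoch `0` the truncated subtraction gives index `0`, and all `t` observations are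
  -- calibration points.
  rcases Nat.eq_zero_or_pos (epoch η t) with h0 | h0
  · rw [h0]
    simp
    exact ⟨by nlinarith, ht⟩
  · obtain ⟨m, hm⟩ : ∃ m, epoch η t = m + 1 := ⟨epoch η t - 1, by omega⟩
    rw [hm] at hle ⊢
    rw [Nat.add_sub_cancel]
    have hmη : η ^ m * η ≤ t := by rw [← pow_succ]; exact hle
    have hpm : 1 ≤ η ^ m := one_le_pow₀ hη.le
    have hc : ⌈η ^ m⌉₊ ≤ t := Nat.ceil_le.2 (by nlinarith)
    have hc2 := Nat.ceil_lt_add_one (by linarith : 0 ≤ η ^ m)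
    refine ⟨?_, by omega⟩
    rw [Nat.cast_sub (by omega)]
    push_cast
    nlinarith

theorem samplingError_pos {η κ : ℝ} {t : ℕ} (hη : 1 < η) (hκ0 : 0 < κ) (hκ1 : κ < 1)
    (ht : 1 ≤ t) : 0 < samplingError η κ t := by
  have ht' : (1 : ℝ) ≤ t := by exact_mod_cast ht
  have hl : 0 < Real.log (2 / κ) := Real.log_pos (by rw [lt_div_iff₀ hκ0]; linarith)
  have : 0 < η - 1 := by linarith
  have : 0 < η := by linarith
  exact Real.sqrt_pos.2 (by positivity)

theorem two_mul_exp_samplingError_le {η κ : ℝ} {t : ℕ} (hη : 1 < η) (hκ0 : 0 < κ) (hκ1 : κ < 1)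
    (ht : 1 ≤ t) :
    2 * Real.exp (-2 * calSize η t (prevEpoch η t) * samplingError η κ t ^ 2) ≤ κ := by
  have ht' : (1 : ℝ) ≤ t := by exact_mod_cast ht
  have hl : 0 < Real.log (2 / κ) := Real.log_pos (by rw [lt_div_iff₀ hκ0]; linarith)
  have h1 : 0 < η - 1 := by linarith
  have h0 : 0 < η := by linarith
  obtain ⟨hn, -⟩ := mul_le_calSize_prevEpoch hη ht
  set n : ℝ := (calSize η t (prevEpoch η t) : ℝ)
  have h2 : Real.log (2 / κ) ≤ 2 * n * samplingError η κ t ^ 2 := by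
    unfold samplingError
    rw [Real.sq_sqrt (by positivity), mul_div_assoc', le_div_iff₀ (by positivity)]
    have := mul_le_mul_of_nonneg_left hn hl.le
    linarith
  have h3 : Real.exp (-2 * n * samplingError η κ t ^ 2) ≤ κ / 2 := by
    rw [← Real.exp_log (by positivity : 0 < κ / 2), Real.exp_le_exp, ← inv_div, Real.log_inv]
    linarith
  linarith

/-- Lower tail of the rescaled empirical distribution function of independent scores. -/
theorem measure_scaledCDF_lt_le {Ω : Type*} [MeasurableSpace Ω] {P : Measure Ω}
    [IsProbabilityMeasure P] {Y : ℕ → Ω → ℝ} (hY : ∀ i, Measurable (Y (i + 1)))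
    (hind : iIndepFun (fun i => Y (i + 1)) P) {F : ℝ → ℝ}
    (hlaw : ∀ i r, P.real {ω | Y (i + 1) ω ≤ r} = F r) {η : ℝ} (hη : 1 < η) {t k : ℕ}
    (hn : 1 ≤ calSize η t k) {p e r : ℝ} (he : 0 ≤ e) (hp : p + e ≤ F r) :
    P {ω | scaledCDF η t k (fun s => Y s ω) r < p} ≤
      ENNReal.ofReal (2 * Real.exp (-2 * calSize η t k * e ^ 2)) := by
  have ha := one_le_natCeil_pow hη k
  -- The independent family is indexed from `0` with `i ↦ Y (i + 1)`, so the calibration window is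
  -- shifted down by one.
  have hcard : (Finset.Ico (⌈η ^ k⌉₊ - 1) t).card = calSize η t k := by
    rw [Nat.card_Ico]; unfold calSize; omega
  have hmain := measure_sum_indicator_lt_le (Finset.Ico (⌈η ^ k⌉₊ - 1) t) (hcard ▸ hn) hY hind
    (measurableSet_Iic (a := r)) (fun i => hlaw i r) he hp
  rw [hcard] at hmain
  refine (measure_mono fun ω hω => ?_).trans hmain
  have hω' : scaledCDF η t k (fun s => Y s ω) r < p := hω
  have hn' : (1 : ℝ) ≤ calSize η t k := by exact_mod_cast hn
  have hsum : ∑ i ∈ Finset.Ico (⌈η ^ k⌉₊ - 1) t,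
      (Set.Iic r).indicator (fun _ => (1 : ℝ)) (Y (i + 1) ω)
      = ∑ s ∈ Finset.Icc ⌈η ^ k⌉₊ t, (Set.Iic r).indicator (fun _ => (1 : ℝ)) (Y s ω) := by
    rw [Finset.sum_Ico_add' (fun s => (Set.Iic r).indicator (fun _ => (1 : ℝ)) (Y s ω)),
      Nat.sub_add_cancel ha]
    rfl
  rw [Set.mem_ofPred_eq, hsum]
  unfold scaledCDF empCDF at hω'
  rw [← mul_assoc, div_mul_div_comm, mul_one, mul_comm ((calSize η t k : ℝ) + 1),
    div_mul_eq_div_div, div_self (by linarith), one_div_mul_eq_div, div_lt_iff₀ (by linarith)] at hω'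
  linarith

/-- For each `e' < e`, continuity provides a point `r < q` with `p + e' < F r`, and the event is
contained in the one-point event at `r`. Letting `e'` increase to `e` recovers the full exponent. -/
theorem measure_forall_lt_scaledCDF_lt_le {Ω : Type*} [MeasurableSpace Ω] {P : Measure Ω}
    [IsProbabilityMeasure P] {Y : ℕ → Ω → ℝ} (hY : ∀ i, Measurable (Y (i + 1)))
    (hind : iIndepFun (fun i => Y (i + 1)) P) {F : ℝ → ℝ} (hF : Continuous F)
    (hlaw : ∀ i r, P.real {ω | Y (i + 1) ω ≤ r} = F r) {η : ℝ} (hη : 1 < η) {t k : ℕ}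
    (hn : 1 ≤ calSize η t k) {p e q : ℝ} (he : 0 < e) (hp : p + e ≤ F q) :
    P {ω | ∀ r < q, scaledCDF η t k (fun s => Y s ω) r < p} ≤
      ENNReal.ofReal (2 * Real.exp (-2 * calSize η t k * e ^ 2)) := by
  have hlim : Tendsto
      (fun e' : ℝ => ENNReal.ofReal (2 * Real.exp (-2 * calSize η t k * e' ^ 2))) (𝓝[<] e)
      (𝓝 (ENNReal.ofReal (2 * Real.exp (-2 * calSize η t k * e ^ 2)))) := by
    have : Continuous
      (fun e' : ℝ => ENNReal.ofReal (2 * Real.exp (-2 * calSize η t k * e' ^ 2))) :=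
      ENNReal.continuous_ofReal.comp (by fun_prop)
    exact (this.tendsto e).mono_left nhdsWithin_le_nhds
  refine ge_of_tendsto hlim ?_
  filter_upwards [Ioo_mem_nhdsLT he] with e' he'
  have h1 : ∀ᶠ r in 𝓝[<] q, p + e' < F r :=
    ((hF.tendsto q).mono_left nhdsWithin_le_nhds).eventually (lt_mem_nhds (by linarith [he'.2]))
  obtain ⟨r, hr, hrq⟩ := (h1.and self_mem_nhdsWithin).exists
  refine le_trans (measure_mono fun ω hω => ?_)
    (measure_scaledCDF_lt_le hY hind hlaw hη hn he'.1.le hr.le)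
  exact hω r hrq

/-! ### The oracle inequality -/

theorem score_le_add_dist {𝒵 Ξ : Type*} [PseudoMetricSpace Ξ] {R : 𝒵 → Ξ → ℝ}
    (hLip : ∀ ξ ξ' : Ξ, ∀ z, |R z ξ - R z ξ'| ≤ dist ξ ξ')
    (ξ ξ' : Ξ) (z : 𝒵) : R z ξ' ≤ R z ξ + dist ξ ξ' := by
  have := (abs_le.1 (hLip ξ ξ' z)).1
  linarith

theorem measureReal_score_le {Ω 𝒵 Ξ : Type*} [MeasurableSpace Ω] [MeasurableSpace 𝒵]
    {P : Measure Ω} {μ : Measure 𝒵} [IsProbabilityMeasure μ] {Z : ℕ → Ω → 𝒵} {R : 𝒵 → Ξ → ℝ}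
    {ξs : Ξ} (hZ : ∀ t, 1 ≤ t → Measurable (Z t))
    (hlaw : ∀ t, 1 ≤ t → P.map (Z t) = μ) (hR : ∀ ξ, Measurable (fun z => R z ξ)) (i : ℕ)
    (r : ℝ) : P.real {ω | R (Z (i + 1) ω) ξs ≤ r} = cdf (μ.map fun z => R z ξs) r := by
  rw [← real_le_eq_cdf (hR ξs), ← hlaw (i + 1) (by omega),
    map_measureReal_apply (hZ _ (by omega)) (measurableSet_le (hR ξs) measurable_const)]
  rfl

section OracleInequality

variable {𝒵 Ξ : Type*} [MeasurableSpace 𝒵]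

/-- The only property of the correction that the oracle inequalities use: it is never `-∞`. -/
theorem correction_eq_top_or_coe (α η : ℝ) (h g : ℕ → ℝ≥0) (t k : ℕ) :
    correction α η h g t k = ⊤ ∨ ∃ u : ℝ, correction α η h g t k = (u : EReal) := by
  unfold correction correctionAt
  split_ifs
  · exact Or.inl rfl
  · exact Or.inr ⟨_, rfl⟩

theorem closedShellSize_top (L : Measure 𝒵) (μ : Measure 𝒵) (R : 𝒵 → Ξ → ℝ) (ξs : Ξ) (α : ℝ) :
    closedShellSize L μ R ξs α ⊤ = L Set.univ := by
  simp [closedShellSize]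

theorem shellSize_top (L : Measure 𝒵) {μ : Measure 𝒵} {R : 𝒵 → Ξ → ℝ} {ξs : Ξ} {α q : ℝ}
    (hq : oracleQuantile μ R ξs (α : EReal) = (q : EReal)) :
    shellSize L μ R ξs α ⊤ = L Set.univ := by
  unfold shellSize
  congr 1
  ext z
  simp only [Set.mem_ofPred_eq, Set.mem_univ, iff_true]
  rw [hq, ← EReal.coe_sub]
  exact EReal.abs_coe_lt_top _

/-- Either the perturbation of the oracle quantile is infinite, or it is controlled by the
quantile at a finite level. -/
theorem quantilePerturbation_eq_top_or {μ : Measure 𝒵} [IsProbabilityMeasure μ]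
    {R : 𝒵 → Ξ → ℝ} {ξs : Ξ} (hR : Measurable (fun z => R z ξs)) {α qs : ℝ}
    (hqs : oracleQuantile μ R ξs (α : EReal) = (qs : EReal)) {u : EReal}
    (hu : u = ⊤ ∨ ∃ v : ℝ, u = (v : EReal)) (e : ℝ) :
    quantilePerturbation μ R ξs α u e = ⊤ ∨ ∃ v q : ℝ, u = (v : EReal) ∧
      1 - α + v + e ≤ cdf (μ.map fun z => R z ξs) q ∧
      ENNReal.ofReal |qs - q| ≤ quantilePerturbation μ R ξs α u e := by
  rcases hu with rfl | ⟨v, rfl⟩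
  · left
    have : oracleQuantile μ R ξs ((α : EReal) - ⊤ + ((-e : ℝ) : EReal)) = ⊤ := by
      rw [EReal.sub_top, EReal.bot_add]
      exact genInv_top _
    unfold quantilePerturbation
    rw [this, EReal.sub_top (oracleQuantile μ R ξs α), EReal.abs_bot, max_top_right]
  -- An upper bound on the set needs only the sign `ω = -1`, the one that raises the quantile level.
  · have hlev : (1 : EReal) - ((α : EReal) - (v : EReal) + ((-e : ℝ) : EReal))
        = ((1 - α + v + e : ℝ) : EReal) := by
      norm_cast; ring
    have hle := le_max_right (oracleQuantile μ R ξs (α : EReal) -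
        oracleQuantile μ R ξs ((α : EReal) - (v : EReal) + (e : EReal))).abs
      (oracleQuantile μ R ξs (α : EReal) -
        oracleQuantile μ R ξs ((α : EReal) - (v : EReal) + ((-e : ℝ) : EReal))).abs
    change _ ≤ quantilePerturbation μ R ξs α v e at hle
    rw [hqs] at hle
    induction hq : oracleQuantile μ R ξs ((α : EReal) - (v : EReal) + ((-e : ℝ) : EReal)) with
    | bot =>
      left
      rw [hq, EReal.sub_bot (EReal.coe_ne_bot _), EReal.abs_top] at hle
      exact top_le_iff.1 hle
    | top =>
      left
      rw [hq, EReal.sub_top, EReal.abs_bot] at hle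
      exact top_le_iff.1 hle
    | coe q =>
      right
      rw [hq, ← EReal.coe_sub, EReal.abs_def] at hle
      refine ⟨v, q, rfl, ?_, hle⟩
      rw [oracleQuantile_eq_genInv_cdf hR, hlev] at hq
      exact le_apply_of_genInv_eq (monotone_cdf _) (fun x => (cdf _).right_continuous x) hq

theorem measure_onlineSet_le (L : Measure 𝒵) (R : 𝒵 → Ξ → ℝ) (α η : ℝ) (h g : ℕ → ℝ≥0)
    (ξ : ℕ → Ξ) (z : ℕ → 𝒵) (t : ℕ) :
    L (onlineSet L R α η h g ξ z t) ≤ L (epochSet R α η h g ξ z t (prevEpoch η t)) := by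
  unfold onlineSet
  split_ifs with hle
  · exact le_rfl
  · exact (not_le.1 hle).le

variable [PseudoMetricSpace Ξ]

/-- One distance is already contained in `hcal`, where empirical quantiles were compared. The second
comes from passing from `R(x; ξ̂)` back to `R(x; ξ*)`. Points with oracle score above `qs` then have
score at most `q + 2D`. -/
theorem measure_epochSet_le_closedShellSize (L : Measure 𝒵) {μ : Measure 𝒵} {R : 𝒵 → Ξ → ℝ}
    (hLip : ∀ ξ ξ' : Ξ, ∀ z, |R z ξ - R z ξ'| ≤ dist ξ ξ') {ξs : Ξ} {α η : ℝ} {h g : ℕ → ℝ≥0}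
    {ξ : ℕ → Ξ} {z : ℕ → 𝒵} {t j : ℕ} {qs q : ℝ}
    (hqs : oracleQuantile μ R ξs (α : EReal) = (qs : EReal))
    (hcal : calQuantile α η t j (correction α η h g t j) (fun s => R (z s) (ξ j))
      ≤ ((q + dist ξs (ξ j) : ℝ) : EReal)) {ρ : ℝ≥0∞} (hρ : ENNReal.ofReal |qs - q| ≤ ρ) :
    L (epochSet R α η h g ξ z t j) ≤ L (oracleSet μ R ξs α) +
      closedShellSize L μ R ξs α (2 * ENNReal.ofReal (dist ξs (ξ j)) + ρ) := by
  refine (measure_mono fun x hx => ?_).trans (measure_union_le _ _)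
  have hx' : ((R x (ξ j) : ℝ) : EReal) ≤ ((q + dist ξs (ξ j) : ℝ) : EReal) := le_trans hx hcal
  rw [EReal.coe_le_coe_iff] at hx'
  have hd := (abs_le.1 (hLip ξs (ξ j) x)).2
  simp only [oracleSet, Set.mem_union, Set.mem_ofPred_eq, hqs, EReal.coe_le_coe_iff]
  by_cases hle : R x ξs ≤ qs
  · exact Or.inl hle
  · right
    rw [← EReal.coe_sub, EReal.abs_def, abs_of_nonneg (by linarith)]
    refine le_trans ?_ (add_le_add_right hρ _)
    rw [← ENNReal.ofReal_ofNat, ← ENNReal.ofReal_mul (by norm_num),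
      ← ENNReal.ofReal_add (by positivity) (by positivity)]
    refine ENNReal.ofReal_le_ofReal ?_
    have := neg_abs_le (qs - q)
    linarith

/-- The slack `r < q` turns the bound on the distance to `qs` into a strict one. -/
theorem measure_epochSet_le_shellSize (L : Measure 𝒵) {μ : Measure 𝒵} {R : 𝒵 → Ξ → ℝ}
    (hLip : ∀ ξ ξ' : Ξ, ∀ z, |R z ξ - R z ξ'| ≤ dist ξ ξ') {ξs : Ξ} {α η : ℝ} {h g : ℕ → ℝ≥0}
    {ξ : ℕ → Ξ} {z : ℕ → 𝒵} {t j : ℕ} {qs q r : ℝ}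
    (hqs : oracleQuantile μ R ξs (α : EReal) = (qs : EReal)) (hr : r < q)
    (hcal : calQuantile α η t j (correction α η h g t j) (fun s => R (z s) (ξ j))
      ≤ ((r + dist ξs (ξ j) : ℝ) : EReal)) {ρ : ℝ≥0∞} (hρ : ENNReal.ofReal |qs - q| ≤ ρ) :
    L (epochSet R α η h g ξ z t j) ≤ L (oracleSet μ R ξs α) +
      shellSize L μ R ξs α (2 * ENNReal.ofReal (dist ξs (ξ j)) + ρ) := by
  refine (measure_mono fun x hx => ?_).trans (measure_union_le _ _)
  have hx' : ((R x (ξ j) : ℝ) : EReal) ≤ ((r + dist ξs (ξ j) : ℝ) : EReal) := le_trans hx hcal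
  rw [EReal.coe_le_coe_iff] at hx'
  have hd := (abs_le.1 (hLip ξs (ξ j) x)).2
  simp only [oracleSet, Set.mem_union, Set.mem_ofPred_eq, hqs, EReal.coe_le_coe_iff]
  by_cases hle : R x ξs ≤ qs
  · exact Or.inl hle
  · right
    rw [← EReal.coe_sub, EReal.abs_def, abs_of_nonneg (by linarith)]
    refine lt_of_lt_of_le ?_ (add_le_add_right hρ _)
    rw [← ENNReal.ofReal_ofNat, ← ENNReal.ofReal_mul (by norm_num),
      ← ENNReal.ofReal_add (by positivity) (by positivity)]
    have := neg_abs_le (qs - q)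
    exact (ENNReal.ofReal_lt_ofReal_iff_of_nonneg (by linarith)).2 (by linarith)

variable {Ω : Type*} [MeasurableSpace Ω] {P : Measure Ω} [IsProbabilityMeasure P]
  {μ L : Measure 𝒵} [IsProbabilityMeasure μ] {Z : ℕ → Ω → 𝒵} {R : 𝒵 → Ξ → ℝ} {ξs : Ξ}
  {ξhat : ℕ → Ω → Ξ} {α η : ℝ} {h g : ℕ → ℝ≥0}

/-- The exceptional event is covered by an event about oracle scores alone. Hence neither
measurability of the estimates nor their independence of the calibration data plays a role. -/
theorem oracle_inequality_closedShell (hZ : ∀ t, 1 ≤ t → Measurable (Z t))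
    (hlaw : ∀ t, 1 ≤ t → P.map (Z t) = μ) (hindep : iIndepFun (fun i : ℕ => Z (i + 1)) P)
    (hR : ∀ ξ, Measurable (fun z => R z ξ))
    (hLip : ∀ ξ ξ' : Ξ, ∀ z, |R z ξ - R z ξ'| ≤ dist ξ ξ')
    (hα0 : 0 < α) (hα1 : α < 1) (hη : 1 < η) {κ : ℝ} (hκ0 : 0 < κ) (hκ1 : κ < 1) {t : ℕ}
    (ht : 1 ≤ t) :
    P {ω | ¬ L (onlineSet L R α η h g (fun k => ξhat k ω) (fun s => Z s ω) t) ≤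
        L (oracleSet μ R ξs α) + closedShellSize L μ R ξs α
          (2 * ENNReal.ofReal (dist ξs (ξhat (prevEpoch η t) ω)) +
            quantilePerturbation μ R ξs α (correction α η h g t (prevEpoch η t))
              (samplingError η κ t))} ≤ ENNReal.ofReal κ := by
  obtain ⟨qs, hqs⟩ := exists_oracleQuantile_eq_coe (μ := μ) (hR ξs) hα0 hα1
  rcases quantilePerturbation_eq_top_or (hR ξs) hqs
    (correction_eq_top_or_coe α η h g t (prevEpoch η t)) (samplingError η κ t)
    with htop | ⟨u, q, hu, hF, hρ⟩
  -- An infinite radius makes the shell the whole space, so the failure event is empty.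
  · simp only [htop, add_top, closedShellSize_top]
    simp only [(measure_mono (Set.subset_univ _)).trans le_add_self, not_true_eq_false]
    simp
  have hn := (mul_le_calSize_prevEpoch hη ht).2
  have htail := measure_scaledCDF_lt_le (Y := fun s ω => R (Z s ω) ξs)
    (fun i => (hR ξs).comp (hZ _ (by omega)))
    (hindep.comp (fun _ z => R z ξs) (fun _ => hR ξs)) (measureReal_score_le hZ hlaw hR) hη hn
    (samplingError_pos hη hκ0 hκ1 ht).le hF
  refine le_trans (measure_mono fun ω hω => ?_)
    (htail.trans (ENNReal.ofReal_le_ofReal (two_mul_exp_samplingError_le hη hκ0 hκ1 ht)))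
  by_contra hge
  refine hω ((measure_onlineSet_le _ _ _ _ _ _ _ _ _).trans
    (measure_epochSet_le_closedShellSize L hLip hqs ?_ hρ))
  refine calQuantile_le_of_dist_le (fun s => score_le_add_dist hLip ξs _ (Z s ω)) ?_
  rw [hu]
  exact_mod_cast not_lt.1 hge

theorem oracle_inequality_shell (hZ : ∀ t, 1 ≤ t → Measurable (Z t))
    (hlaw : ∀ t, 1 ≤ t → P.map (Z t) = μ) (hindep : iIndepFun (fun i : ℕ => Z (i + 1)) P)
    (hR : ∀ ξ, Measurable (fun z => R z ξ))
    (hLip : ∀ ξ ξ' : Ξ, ∀ z, |R z ξ - R z ξ'| ≤ dist ξ ξ')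
    (hα0 : 0 < α) (hα1 : α < 1) (hη : 1 < η)
    (hcont : Continuous (fun r : ℝ => μ.real {z | R z ξs ≤ r}))
    {κ : ℝ} (hκ0 : 0 < κ) (hκ1 : κ < 1) {t : ℕ} (ht : 1 ≤ t) :
    P {ω | ¬ L (onlineSet L R α η h g (fun k => ξhat k ω) (fun s => Z s ω) t) ≤
        L (oracleSet μ R ξs α) + shellSize L μ R ξs α
          (2 * ENNReal.ofReal (dist ξs (ξhat (prevEpoch η t) ω)) +
            quantilePerturbation μ R ξs α (correction α η h g t (prevEpoch η t))
              (samplingError η κ t))} ≤ ENNReal.ofReal κ := by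
  obtain ⟨qs, hqs⟩ := exists_oracleQuantile_eq_coe (μ := μ) (hR ξs) hα0 hα1
  rcases quantilePerturbation_eq_top_or (hR ξs) hqs
    (correction_eq_top_or_coe α η h g t (prevEpoch η t)) (samplingError η κ t)
    with htop | ⟨u, q, hu, hF, hρ⟩
  · simp only [htop, add_top, shellSize_top L hqs]
    simp only [(measure_mono (Set.subset_univ _)).trans le_add_self, not_true_eq_false]
    simp
  have hn := (mul_le_calSize_prevEpoch hη ht).2
  simp only [real_le_eq_cdf (hR ξs)] at hcont
  have htail := measure_forall_lt_scaledCDF_lt_le (Y := fun s ω => R (Z s ω) ξs)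
    (fun i => (hR ξs).comp (hZ _ (by omega)))
    (hindep.comp (fun _ z => R z ξs) (fun _ => hR ξs)) hcont (measureReal_score_le hZ hlaw hR)
    hη hn (samplingError_pos hη hκ0 hκ1 ht) hF
  refine le_trans (measure_mono fun ω hω => ?_)
    (htail.trans (ENNReal.ofReal_le_ofReal (two_mul_exp_samplingError_le hη hκ0 hκ1 ht)))
  by_contra hge
  rw [Set.mem_ofPred_eq] at hge
  push Not at hge
  obtain ⟨r, hrq, hr⟩ := hge
  refine hω ((measure_onlineSet_le _ _ _ _ _ _ _ _ _).trans
    (measure_epochSet_le_shellSize L hLip hqs hrq ?_ hρ))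
  refine calQuantile_le_of_dist_le (fun s => score_le_add_dist hLip ξs _ (Z s ω)) ?_
  rw [hu]
  exact_mod_cast hr

end OracleInequality

/-! ### The rate -/

theorem exists_cdf_growth {ν : Measure ℝ} [IsProbabilityMeasure ν] {x : ℝ}
    (hν : DensityBoundedBelowNear ν x) :
    ∃ c δ : ℝ, 0 < c ∧ 0 < δ ∧ ∀ a b, x - δ < a → a ≤ b → b < x + δ →
      c * (b - a) ≤ cdf ν b - cdf ν a := by
  obtain ⟨f, δ, c, -, hδ, hc, hfν, hcf⟩ := hν
  -- The lower bound `c` on the density may be infinite; truncating at `1` gives a real growth rate.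
  have hm1 : min c 1 ≠ ⊤ := ne_top_of_le_ne_top ENNReal.one_ne_top (min_le_right _ _)
  refine ⟨(min c 1).toReal, δ, ENNReal.toReal_pos (by simp [hc.ne']) hm1, hδ, ?_⟩
  intro a b ha hab hb
  have hsub : Set.Ioc a b ⊆ Set.Ioo (x - δ) (x + δ) := fun y hy =>
    ⟨ha.trans hy.1, hy.2.trans_lt hb⟩
  have h1 : ν (Set.Ioc a b) = ∫⁻ y in Set.Ioc a b, f y := by
    rw [← Measure.restrict_eq_self ν hsub, hfν, withDensity_apply _ measurableSet_Ioc,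
      Measure.restrict_restrict measurableSet_Ioc, Set.inter_eq_left.2 hsub]
  have h2 : min c 1 * ENNReal.ofReal (b - a) ≤ ν (Set.Ioc a b) := by
    rw [h1, ← Real.volume_Ioc, ← setLIntegral_const]
    exact setLIntegral_mono' measurableSet_Ioc fun y hy => (min_le_left _ _).trans (hcf y (hsub hy))
  have h3 : ν.real (Set.Ioc a b) = cdf ν b - cdf ν a := by
    have h4 : Set.Ioc a b = Set.Iic b \ Set.Iic a := by ext y; simp [and_comm]
    rw [cdf_eq_real, cdf_eq_real, h4,
      measureReal_sdiff (Set.Iic_subset_Iic.2 hab) measurableSet_Iic]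
  rw [← h3, Measure.real]
  have h4 := ENNReal.toReal_mono (measure_ne_top ν _) h2
  rwa [ENNReal.toReal_mul, ENNReal.toReal_ofReal (by linarith)] at h4

theorem samplingError_eq_div_sqrt (η κ : ℝ) (t : ℕ) :
    samplingError η κ t = √(η * Real.log (2 / κ) / (2 * (η - 1))) * (1 / √(t : ℝ)) := by
  unfold samplingError
  rw [← Real.sqrt_one, ← Real.sqrt_div zero_le_one, Real.sqrt_one,
    ← Real.sqrt_mul' _ (by positivity)]
  congr 1
  rw [div_mul_div_comm, mul_one]
  ring

theorem tendsto_one_div_sqrt_natCast : Tendsto (fun t : ℕ => 1 / √(t : ℝ)) atTop (𝓝 0) := by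
  simp only [one_div]
  exact tendsto_inv_atTop_zero.comp (Real.tendsto_sqrt_atTop.comp tendsto_natCast_atTop_atTop)

theorem tendsto_prevEpoch {η : ℝ} (hη : 1 < η) : Tendsto (prevEpoch η) atTop atTop := by
  have h1 : Tendsto (fun t : ℕ => ⌊Real.logb η t⌋₊) atTop atTop :=
    tendsto_nat_floor_atTop.comp ((Real.tendsto_logb_atTop hη).comp tendsto_natCast_atTop_atTop)
  exact (tendsto_sub_atTop_nat 1).comp h1

section Rate

variable {𝒵 Ξ : Type*} [MeasurableSpace 𝒵]

/-- Both signs shift the level by at most `|u| + e`, so local Lipschitz stability of the quantile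
with constant `1 / c` covers the maximum. -/
theorem quantilePerturbation_le {μ : Measure 𝒵} [IsProbabilityMeasure μ] {R : 𝒵 → Ξ → ℝ}
    {ξs : Ξ} (hR : Measurable (fun z => R z ξs)) {α qs c δ : ℝ} (hc : 0 < c)
    (hqs : oracleQuantile μ R ξs (α : EReal) = (qs : EReal))
    (hgrow : ∀ a b, qs - δ < a → a ≤ b → b < qs + δ → c * (b - a) ≤
      cdf (μ.map fun z => R z ξs) b - cdf (μ.map fun z => R z ξs) a)
    {u e : ℝ} (he : 0 ≤ e) (hue : |u| + e < c * δ) :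
    quantilePerturbation μ R ξs α (u : EReal) e ≤ ENNReal.ofReal ((|u| + e) / c) := by
  have h1 : genInv (cdf (μ.map fun z => R z ξs)) ((1 - α : ℝ) : EReal) = (qs : EReal) := by
    rw [← hqs, oracleQuantile_eq_genInv_cdf hR]; norm_cast
  have key : ∀ e' : ℝ, |e'| = e →
      ((qs : EReal) - oracleQuantile μ R ξs ((α : EReal) - (u : EReal) + (e' : EReal))).abs
        ≤ ENNReal.ofReal ((|u| + e) / c) := by
    intro e' he'
    have h2 : |u - e'| ≤ |u| + e := he' ▸ abs_sub u e'
    obtain ⟨q', hq', hle⟩ := genInv_stable (monotone_cdf _)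
      (fun x => (cdf (μ.map fun z => R z ξs)).right_continuous x) hc h1 hgrow (h2.trans_lt hue)
    have hlev : (1 : EReal) - ((α : EReal) - (u : EReal) + (e' : EReal))
        = ((1 - α + (u - e') : ℝ) : EReal) := by
      norm_cast; ring
    rw [oracleQuantile_eq_genInv_cdf hR, hlev, hq', ← EReal.coe_sub, EReal.abs_def]
    exact ENNReal.ofReal_le_ofReal (hle.trans (by gcongr))
  unfold quantilePerturbation
  rw [hqs]
  exact max_le (key e (abs_of_nonneg he)) (key (-e) (by rw [abs_neg, abs_of_nonneg he]))

theorem closedShellSize_mono (L μ : Measure 𝒵) (R : 𝒵 → Ξ → ℝ) (ξs : Ξ) (α : ℝ) {ε ε' : ℝ≥0∞}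
    (h : ε ≤ ε') : closedShellSize L μ R ξs α ε ≤ closedShellSize L μ R ξs α ε' :=
  measure_mono fun _ hz => le_trans hz h

theorem closedShellSize_le_shellSize (L μ : Measure 𝒵) (R : 𝒵 → Ξ → ℝ) (ξs : Ξ) (α : ℝ)
    {ε ε' : ℝ≥0∞} (h : ε < ε') : closedShellSize L μ R ξs α ε ≤ shellSize L μ R ξs α ε' :=
  measure_mono fun _ hz => lt_of_le_of_lt hz h

variable [PseudoMetricSpace Ξ] {Ω : Type*} [MeasurableSpace Ω] {P : Measure Ω}
  [IsProbabilityMeasure P] {μ L : Measure 𝒵} [IsProbabilityMeasure μ] {Z : ℕ → Ω → 𝒵}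
  {R : 𝒵 → Ξ → ℝ} {ξs : Ξ} {ξhat : ℕ → Ω → Ξ} {α η : ℝ} {h g : ℕ → ℝ≥0}

theorem online_rate (hZ : ∀ t, 1 ≤ t → Measurable (Z t))
    (hlaw : ∀ t, 1 ≤ t → P.map (Z t) = μ) (hindep : iIndepFun (fun i : ℕ => Z (i + 1)) P)
    (hR : ∀ ξ, Measurable (fun z => R z ξ))
    (hLip : ∀ ξ ξ' : Ξ, ∀ z, |R z ξ - R z ξ'| ≤ dist ξ ξ')
    (hα0 : 0 < α) (hα1 : α < 1) (hη : 1 < η)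
    (hdens : DensityBoundedBelowNear (μ.map (fun z => R z ξs))
      (oracleQuantile μ R ξs (α : EReal)).toReal)
    (hlin : LinearNearZero (shellSize L μ R ξs α))
    (hest : ∀ ε : ℝ, 0 < ε → Tendsto (fun k => P {ω | ε ≤ dist ξs (ξhat k ω)}) atTop (𝓝 0))
    (hcorr : Tendsto (fun t => correction α η h g t (prevEpoch η t)) atTop (𝓝 (0 : EReal))) :
    ∃ A B : ℕ → Ω → ℝ≥0∞, BoundedInProbability P A ∧ BoundedInProbability P B ∧
      ∀ᶠ t in atTop, ∀ ω,
        L (onlineSet L R α η h g (fun k => ξhat k ω) (fun s => Z s ω) t) ≤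
          L (oracleSet μ R ξs α) +
          A t ω * ENNReal.ofReal (dist ξs (ξhat (prevEpoch η t) ω)) +
          B t ω * (ENNReal.ofReal (1 / √(t : ℝ)) + (correction α η h g t (prevEpoch η t)).abs) := by
  obtain ⟨qs, hqs⟩ := exists_oracleQuantile_eq_coe (μ := μ) (hR ξs) hα0 hα1
  rw [hqs, EReal.toReal_coe] at hdens
  have := Measure.isProbabilityMeasure_map (μ := μ) (hR ξs).aemeasurable
  obtain ⟨c, δ, hc, hδ, hgrow⟩ := exists_cdf_growth hdens
  obtain ⟨_, b, -, ε₀, hε₀, hb⟩ := hlin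
  set u : ℕ → ℝ := fun t => (correction α η h g t (prevEpoch η t)).toReal with hu
  have hu0 : Tendsto u atTop (𝓝 0) :=
    (EReal.tendsto_toReal (EReal.coe_ne_top 0) (EReal.coe_ne_bot 0)).comp hcorr
  have hucoe : ∀ᶠ t in atTop, correction α η h g t (prevEpoch η t) = (u t : EReal) := by
    filter_upwards [hcorr.eventually (gt_mem_nhds (EReal.coe_lt_top 0)),
      hcorr.eventually (lt_mem_nhds (EReal.bot_lt_coe 0))] with t h1 h2
    exact (EReal.coe_toReal h1.ne h2.ne').symm
  set w : ℕ → ℝ := fun t => 1 / √(t : ℝ) + |u t| with hw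
  have hw0 : Tendsto w atTop (𝓝 0) := by
    have := tendsto_one_div_sqrt_natCast.add hu0.abs
    rwa [abs_zero, add_zero] at this
  have hwpos : ∀ᶠ t in atTop, 0 < w t := by
    filter_upwards [eventually_ge_atTop 1] with t ht
    have : (0 : ℝ) < t := by exact_mod_cast ht
    simp only [hw]
    positivity
  have hweq : ∀ᶠ t : ℕ in atTop, ENNReal.ofReal (1 / √(t : ℝ)) +
      (correction α η h g t (prevEpoch η t)).abs = ENNReal.ofReal (w t) := by
    filter_upwards [hucoe] with t ht
    rw [ht, EReal.abs_def, ← ENNReal.ofReal_add (by positivity) (by positivity)]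
  set ℓ : ℕ → Ω → ℝ≥0∞ := fun t ω =>
    L (onlineSet L R α η h g (fun k => ξhat k ω) (fun s => Z s ω) t) with hℓ
  set D : ℕ → Ω → ℝ := fun t ω => dist ξs (ξhat (prevEpoch η t) ω) with hD
  -- `A` is constant and `B` is the normalised excess, with truncated subtraction. The inequality
  -- then holds surely once `w t > 0` and the correction is finite, and all the probability is in
  -- the tightness of `B`.
  refine ⟨fun _ _ => ((4 * b : ℝ≥0) : ℝ≥0∞), fun t ω => (ℓ t ω - (L (oracleSet μ R ξs α) +
    ((4 * b : ℝ≥0) : ℝ≥0∞) * ENNReal.ofReal (D t ω))) / ENNReal.ofReal (w t), ?_, ?_, ?_⟩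
  · exact fun κ _ => ⟨4 * b, Eventually.of_forall fun t => by simp⟩
  · intro κ hκ
    obtain ⟨κ', hκ'0, hκ'1, hκ'⟩ : ∃ κ' : ℝ, 0 < κ' ∧ κ' < 1 ∧
        ENNReal.ofReal κ' + ENNReal.ofReal κ' ≤ κ := by
      have hm1 : min κ 1 ≠ ⊤ := ne_top_of_le_ne_top ENNReal.one_ne_top (min_le_right _ _)
      have hm0 : 0 < (min κ 1).toReal := ENNReal.toReal_pos (by simp [hκ.ne']) hm1
      have hm2 : (min κ 1).toReal ≤ 1 := ENNReal.toReal_mono ENNReal.one_ne_top (min_le_right _ _)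
      refine ⟨(min κ 1).toReal / 2, by linarith, by linarith, ?_⟩
      rw [← ENNReal.ofReal_add (by linarith) (by linarith), add_halves, ENNReal.ofReal_toReal hm1]
      exact min_le_left _ _
    obtain ⟨C, hC⟩ : ∃ C, C = √(η * Real.log (2 / κ') / (2 * (η - 1))) := ⟨_, rfl⟩
    have hC0 : 0 ≤ C := by rw [hC]; positivity
    -- The sampling error is `C / √t`, so `|u| + e ≤ (1 + C) w`, and the quantile moves by at most
    -- `K w`.
    obtain ⟨K, hK⟩ : ∃ K, K = (1 + C) / c := ⟨_, rfl⟩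
    have hK0 : 0 < K := by rw [hK]; positivity
    have hε₀' : (0 : ℝ) < ε₀ := by exact_mod_cast hε₀
    -- With `D < ε₀ / 8` and `K w < ε₀ / 4`, the doubled radius `2 (2 D + K w)` stays below `ε₀`.
    have hlimD := (hest (ε₀ / 8) (by positivity)).comp (tendsto_prevEpoch hη)
    have hlimK : ∀ᶠ t in atTop, K * w t < ε₀ / 4 := by
      have : Tendsto (fun t => K * w t) atTop (𝓝 0) := by simpa using hw0.const_mul K
      exact this.eventually (gt_mem_nhds (by positivity))
    have hlimδ : ∀ᶠ t in atTop, (1 + C) * w t < c * δ := by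
      have : Tendsto (fun t => (1 + C) * w t) atTop (𝓝 0) := by simpa using hw0.const_mul (1 + C)
      exact this.eventually (gt_mem_nhds (by positivity))
    refine ⟨4 * b * K.toNNReal, ?_⟩
    filter_upwards [eventually_ge_atTop 1, hucoe, hwpos, hlimK, hlimδ,
      hlimD.eventually (ge_mem_nhds (ENNReal.ofReal_pos.2 hκ'0))] with t ht hut hwt hKt hδt hDt
    have hmain := oracle_inequality_closedShell (P := P) (L := L) (ξs := ξs) (ξhat := ξhat) (h := h)
      (g := g) hZ hlaw hindep hR hLip hα0 hα1 hη hκ'0 hκ'1 ht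
    refine le_trans ((measure_mono fun ω hω => ?_).trans (measure_union_le _ _))
      ((add_le_add hmain hDt).trans hκ')
    by_contra hgood
    rw [Set.mem_union, not_or] at hgood
    obtain ⟨hg1, hg2⟩ := hgood
    have hg1' := not_not.1 hg1
    have hg2' : D t ω < ε₀ / 8 := not_le.1 hg2
    have hD0 : 0 ≤ D t ω := dist_nonneg
    have hue : |u t| + samplingError η κ' t ≤ (1 + C) * w t := by
      rw [samplingError_eq_div_sqrt, ← hC]
      have h1 : 0 ≤ 1 / √(t : ℝ) := by positivity
      have h2 : 0 ≤ C * |u t| := by positivity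
      simp only [hw]
      linarith
    have hpert := quantilePerturbation_le (hR ξs) hc hqs hgrow
      (samplingError_pos hη hκ'0 hκ'1 ht).le (hue.trans_lt hδt)
    have hpert' : (|u t| + samplingError η κ' t) / c ≤ K * w t := by
      rw [hK, div_mul_eq_mul_div]; gcongr
    rw [hut] at hg1'
    have hrad : 2 * ENNReal.ofReal (D t ω) +
        quantilePerturbation μ R ξs α (u t) (samplingError η κ' t)
        ≤ ENNReal.ofReal (2 * D t ω + K * w t) := by
      rw [ENNReal.ofReal_add (by positivity) (by positivity), ENNReal.ofReal_mul (by norm_num),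
        ENNReal.ofReal_ofNat]
      exact add_le_add_right (hpert.trans (ENNReal.ofReal_le_ofReal hpert')) _
    have hx0 : 0 < 2 * D t ω + K * w t := by positivity
    have hshell : closedShellSize L μ R ξs α (2 * ENNReal.ofReal (D t ω) +
        quantilePerturbation μ R ξs α (u t) (samplingError η κ' t))
        ≤ b * ENNReal.ofReal (2 * (2 * D t ω + K * w t)) := by
      refine (closedShellSize_mono L μ R ξs α hrad).trans ?_
      -- Linear growth is assumed for the open shell. Doubling the positive radius passes from the
      -- closed to the open one, and accounts for the coefficient `4 b` of `D`.
      refine (closedShellSize_le_shellSize L μ R ξs α (ε' :=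
        ENNReal.ofReal (2 * (2 * D t ω + K * w t)))
        ((ENNReal.ofReal_lt_ofReal_iff (by linarith)).2 (by linarith))).trans ?_
      refine (hb (2 * (2 * D t ω + K * w t)).toNNReal (Real.toNNReal_pos.2 (by linarith)) ?_).2
      rw [Real.toNNReal_le_iff_le_coe]
      linarith
    have hfin : ℓ t ω ≤ ((4 * b * K.toNNReal : ℝ≥0) : ℝ≥0∞) * ENNReal.ofReal (w t) +
        (L (oracleSet μ R ξs α) + ((4 * b : ℝ≥0) : ℝ≥0∞) * ENNReal.ofReal (D t ω)) := by
      refine hg1'.trans ((add_le_add_right hshell _).trans ?_)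
      have e1 : (b : ℝ≥0∞) * ENNReal.ofReal (2 * (2 * D t ω + K * w t))
          = ((4 * b : ℝ≥0) : ℝ≥0∞) * ENNReal.ofReal (D t ω)
            + 2 * b * ENNReal.ofReal K * ENNReal.ofReal (w t) := by
        have h2 : ((4 * b : ℝ≥0) : ℝ≥0∞) = 2 * 2 * b := by
          rw [ENNReal.coe_mul]; congr 1; norm_num
        rw [h2, ENNReal.ofReal_mul two_pos.le, ENNReal.ofReal_add (by positivity) (by positivity),
          ENNReal.ofReal_mul two_pos.le, ENNReal.ofReal_mul hK0.le, ENNReal.ofReal_ofNat]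
        ring
      rw [e1, ← add_assoc, add_comm]
      gcongr
      rw [ENNReal.coe_mul, ENNReal.coe_mul]
      show (2 : ℝ≥0∞) * b * ENNReal.ofReal K ≤ _ * b * ENNReal.ofReal K
      gcongr
      norm_num
    refine absurd hω (not_lt.2 (ENNReal.div_le_of_le_mul (tsub_le_iff_right.2 hfin)))
  · filter_upwards [hweq, hwpos] with t ht hwt ω
    rw [ht, ENNReal.div_mul_cancel (ENNReal.ofReal_pos.2 hwt).ne' ENNReal.ofReal_ne_top]
    exact le_add_tsub

end Rate

end OnlineTUC

theorem mainTheorem6 {Ω 𝒵 Ξ : Type*} [MeasurableSpace Ω] [MeasurableSpace 𝒵]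
    [PseudoMetricSpace Ξ]
    (P : Measure Ω) [IsProbabilityMeasure P]
    -- the law of the data, and the measure of size (for example Lebesgue measure)
    (μ L : Measure 𝒵)
    -- i.i.d. observations `Z 1, Z 2, …` with law `μ`
    (Z : ℕ → Ω → 𝒵) (hZ : ∀ t, 1 ≤ t → Measurable (Z t))
    (hlaw : ∀ t, 1 ≤ t → P.map (Z t) = μ)
    (hindep : iIndepFun (fun i : ℕ => Z (i + 1)) P)
    -- the score, uniformly Lipschitz in the nuisance parameter
    (R : 𝒵 → Ξ → ℝ) (hR : ∀ ξ, Measurable (fun z => R z ξ))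
    (hLip : ∀ ξ ξ' : Ξ, ∀ z, |R z ξ - R z ξ'| ≤ dist ξ ξ')
    -- the target and arbitrary estimates `ξhat k` of it, one for each epoch
    (ξs : Ξ) (ξhat : ℕ → Ω → Ξ)
    (α η : ℝ) (hα0 : 0 < α) (hα1 : α < 1) (hη : 1 < η)
    (h g : ℕ → ℝ≥0) (hh : HasSum h 1) (hg : HasSum g 1) :
    -- the oracle inequality, with the closed shell
    (∀ κ : ℝ, 0 < κ → κ < 1 → ∀ t : ℕ, 1 ≤ t →
      P {ω | ¬ L (OnlineTUC.onlineSet L R α η h g (fun k => ξhat k ω) (fun s => Z s ω) t) ≤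
          L (OnlineTUC.oracleSet μ R ξs α) +
          OnlineTUC.closedShellSize L μ R ξs α
            (2 * ENNReal.ofReal (dist ξs (ξhat (OnlineTUC.prevEpoch η t) ω)) +
              OnlineTUC.quantilePerturbation μ R ξs α
                (OnlineTUC.correction α η h g t (OnlineTUC.prevEpoch η t))
                (OnlineTUC.samplingError η κ t))} ≤ ENNReal.ofReal κ) ∧
    -- the oracle inequality with the open shell, when `R(Z; ξ*)` has a continuous distribution
    (Continuous (fun r : ℝ => μ.real {z | R z ξs ≤ r}) →
      ∀ κ : ℝ, 0 < κ → κ < 1 → ∀ t : ℕ, 1 ≤ t →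
      P {ω | ¬ L (OnlineTUC.onlineSet L R α η h g (fun k => ξhat k ω) (fun s => Z s ω) t) ≤
          L (OnlineTUC.oracleSet μ R ξs α) +
          OnlineTUC.shellSize L μ R ξs α
            (2 * ENNReal.ofReal (dist ξs (ξhat (OnlineTUC.prevEpoch η t) ω)) +
              OnlineTUC.quantilePerturbation μ R ξs α
                (OnlineTUC.correction α η h g t (OnlineTUC.prevEpoch η t))
                (OnlineTUC.samplingError η κ t))} ≤ ENNReal.ofReal κ) ∧
    -- the rate
    (OnlineTUC.DensityBoundedBelowNear (μ.map (fun z => R z ξs))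
        (OnlineTUC.oracleQuantile μ R ξs (α : EReal)).toReal →
      OnlineTUC.LinearNearZero (OnlineTUC.shellSize L μ R ξs α) →
      (∀ ε : ℝ, 0 < ε →
        Tendsto (fun k => P {ω | ε ≤ dist ξs (ξhat k ω)}) atTop (𝓝 0)) →
      Tendsto (fun t => OnlineTUC.correction α η h g t (OnlineTUC.prevEpoch η t))
        atTop (𝓝 (0 : EReal)) →
      ∃ A B : ℕ → Ω → ℝ≥0∞,
        OnlineTUC.BoundedInProbability P A ∧ OnlineTUC.BoundedInProbability P B ∧
        ∀ᶠ t in atTop, ∀ ω,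
          L (OnlineTUC.onlineSet L R α η h g (fun k => ξhat k ω) (fun s => Z s ω) t) ≤
            L (OnlineTUC.oracleSet μ R ξs α) +
            A t ω * ENNReal.ofReal (dist ξs (ξhat (OnlineTUC.prevEpoch η t) ω)) +
            B t ω * (ENNReal.ofReal (1 / √(t : ℝ)) +
              (OnlineTUC.correction α η h g t (OnlineTUC.prevEpoch η t)).abs)) := by
  have : IsProbabilityMeasure μ := hlaw 1 le_rfl ▸
    Measure.isProbabilityMeasure_map (hZ 1 le_rfl).aemeasurable
  exact ⟨fun κ hκ0 hκ1 t ht => OnlineTUC.oracle_inequality_closedShell hZ hlaw hindep hR hLip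
      hα0 hα1 hη hκ0 hκ1 ht,
    fun hcont κ hκ0 hκ1 t ht => OnlineTUC.oracle_inequality_shell hZ hlaw hindep hR hLip
      hα0 hα1 hη hcont hκ0 hκ1 ht,
    OnlineTUC.online_rate hZ hlaw hindep hR hLip hα0 hα1 hη⟩
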